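/- Let $m_1,m_2,m_3,m_4>0$ and let $q_1,q_2,q_3,q_4\in\mathbb R^2$ be distinct points with distances $r_{ij}=\|q_i-q_j\|$ forming a central configuration: for some real $\ell$, \[ \ell\, m_i\,(q_i-q_{CM})=\sum_{j\ne i}\frac{m_im_j(q_j-q_i)}{r_{ij}^3}\quad(1\le i\le 4),\qquad q_{CM}=\frac{\sum_i m_iq_i}{\sum_i m_i}. \] Suppose the configuration is standard convex: no three of the points are collinear, no point lies in the convex hull of the other three, and the points are numbered consecutively along the boundary of the convex quadrilateral they determine, so that the segments $q_1q_3$ and $q_2q_4$ are its diagonals. Let $\theta_{ijk}\in(0,\pi)$ be the angle at $q_j$ of the triangle $q_iq_jq_k$ and $\theta\in(0,\pi)$ the angle between the diagonal vectors $q_3-q_1$ and $q_4-q_2$. Consider the central configuration equations in terms of angles, with Lagrange multipliers $\lambda,\eta_1\in\mathbb R$: \begin{align*} r_{12}^{-3}&=\lambda+\tfrac{\eta_1}{m_1m_2}\left[\cot\theta-\cot\theta_{142}\right],\\ r_{13}^{-3}&=\lambda+\tfrac{\eta_1}{m_1m_3}\left[\tfrac{r_{24}}{r_{13}}\csc\theta\right],\\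 r_{14}^{-3}&=\lambda+\tfrac{\eta_1}{m_1m_4}\left[-\cot\theta-\cot\theta_{124}\right],\\ r_{23}^{-3}&=\lambda+\tfrac{\eta_1}{m_2m_3}\left[-\cot\theta-\cot\theta_{243}\right],\\ r_{24}^{-3}&=\lambda+\tfrac{\eta_1}{m_2m_4}\left[\tfrac{r_{13}}{r_{24}}\csc\theta-\cot\theta_{234}-\cot\theta_{214}\right],\\ r_{34}^{-3}&=\lambda+\tfrac{\eta_1}{m_3m_4}\left[\cot\theta-\cot\theta_{324}\right], \end{align*} together with $\Delta=A_1+A_3$, where $\Delta=\frac12\|(q_3-q_1)\times(q_4-q_2)\|$ and $A_1$, $A_3$ are the areas of the triangles $q_2q_3q_4$ and $q_1q_2q_4$. Then there are $\lambda,\eta_1\in\mathbb R$ satisfying these equations, and every such $\eta_1$ is negative: $\eta_1<0$. -/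

import Mathlib

noncomputable section

namespace FourBody

/-- The Euclidean plane. -/
abbrev Plane : Type := EuclideanSpace ℝ (Fin 2)

/-- The scalar cross product of two plane vectors; its absolute value is the length of the usual
cross product. -/
def cross (u v : Plane) : ℝ := u 0 * v 1 - u 1 * v 0

/-- Planar central configurations of four bodies with masses `m` and (distinct) positions `q`:
`l mᵢ (qᵢ - q_CM) = ∑_{j ≠ i} mᵢ mⱼ (qⱼ - qᵢ) / rᵢⱼ³` for some real `l` and all `i`. -/
def IsCentralConfiguration (m : Fin 4 → ℝ) (q : Fin 4 → Plane) : Prop :=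
  Function.Injective q ∧
    ∃ l : ℝ, ∀ i : Fin 4,
      (l * m i) • (q i - Finset.univ.centerMass m q) =
        ∑ j ∈ Finset.univ.erase i, (m i * m j / dist (q i) (q j) ^ 3) • (q j - q i)

/-- Standard planar convex configurations. The bodies `1, 2, 3, 4` have indices `0, 1, 2, 3`. -/
structure IsStandardConvex (q : Fin 4 → Plane) : Prop where
  /-- No two points coincide and no three points lie on a line. -/
  nondegenerate : ∀ i j k : Fin 4, i ≠ j → i ≠ k → j ≠ k → ¬ Collinear ℝ {q i, q j, q k}
  /-- No point lies in the convex hull of the others. -/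
  convex : ConvexIndependent ℝ q
  /-- The points are numbered consecutively along the boundary of the convex quadrilateral, so
  that `12, 23, 34, 14` are its sides and `13, 24` its diagonals: among the three ways to pair the
  vertices, the diagonals are the pair of segments that cross. -/
  ordered : (segment ℝ (q 0) (q 2) ∩ segment ℝ (q 1) (q 3)).Nonempty

/-- The angle between the diagonal vectors `q₃ - q₁` and `q₄ - q₂`. -/
def diagonalAngle (q : Fin 4 → Plane) : ℝ :=
  InnerProductGeometry.angle (q 2 - q 0) (q 3 - q 1)

/-- `θᵢⱼₖ`, the angle at the vertex `j` of the triangle `i j k`. -/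
def vertexAngle (q : Fin 4 → Plane) (i j k : Fin 4) : ℝ :=
  EuclideanGeometry.angle (q i) (q j) (q k)

/-- The planarity constraint function `F₁ = Δ - A₁ - A₃`: half the length of the cross product of
the diagonals, minus the areas of the triangles `2 3 4` and `1 2 4`. -/
def planarityConstraint (q : Fin 4 → Plane) : ℝ :=
  |cross (q 2 - q 0) (q 3 - q 1)| / 2
    - |cross (q 2 - q 1) (q 3 - q 2)| / 2
    - |cross (q 0 - q 3) (q 1 - q 0)| / 2

/-- The equations in terms of angles for four-body central configurations, with Lagrange
multipliers `l` (for the moment of inertia) and `η₁` (for the constraint `F₁ = 0`). -/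
structure AngleEquations (m : Fin 4 → ℝ) (q : Fin 4 → Plane) (l η₁ : ℝ) : Prop where
  eq12 : (dist (q 0) (q 1) ^ 3)⁻¹ = l + η₁ / (m 0 * m 1) *
    (Real.cot (diagonalAngle q) - Real.cot (vertexAngle q 0 3 1))
  eq13 : (dist (q 0) (q 2) ^ 3)⁻¹ = l + η₁ / (m 0 * m 2) *
    (dist (q 1) (q 3) / dist (q 0) (q 2) * (Real.sin (diagonalAngle q))⁻¹)
  eq14 : (dist (q 0) (q 3) ^ 3)⁻¹ = l + η₁ / (m 0 * m 3) *
    (-Real.cot (diagonalAngle q) - Real.cot (vertexAngle q 0 1 3))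
  eq23 : (dist (q 1) (q 2) ^ 3)⁻¹ = l + η₁ / (m 1 * m 2) *
    (-Real.cot (diagonalAngle q) - Real.cot (vertexAngle q 1 3 2))
  eq24 : (dist (q 1) (q 3) ^ 3)⁻¹ = l + η₁ / (m 1 * m 3) *
    (dist (q 0) (q 2) / dist (q 1) (q 3) * (Real.sin (diagonalAngle q))⁻¹
      - Real.cot (vertexAngle q 1 2 3) - Real.cot (vertexAngle q 1 0 3))
  eq34 : (dist (q 2) (q 3) ^ 3)⁻¹ = l + η₁ / (m 2 * m 3) *
    (Real.cot (diagonalAngle q) - Real.cot (vertexAngle q 2 1 3))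
  planar : planarityConstraint q = 0

end FourBody

end

/-!
Let the diagonals cross at `q₁ + s (q₃ - q₁) = q₂ + t (q₄ - q₂)`. The affine dependencies of the
four points are the multiples of `w = (1 - s, -(1 - t), s, -t)`, and the central configuration
equations say that the rows of `mᵢ mⱼ (rᵢⱼ⁻³ - l)` are such dependencies off the diagonal; since
this matrix is symmetric, it equals `ν wᵢ wⱼ` off the diagonal, which is Dziobek's theorem. In the
basis of the diagonal vectors the brackets of the angle equations all turn into the products
`wᵢ wⱼ` times one positive factor, so the angle equations are Dziobek's equations with `ν` rescaled.
Since `w₁ w₂, w₃ w₄ < 0 < w₁ w₃, w₂ w₄`, a multiplier `ν ≥ 0` would give `r₁₃ ≤ r₁₂` and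
`r₂₄ ≤ r₃₄`, although `r₁₂ + r₃₄ < r₁₃ + r₂₄` by the triangle inequality at the crossing point.
-/

namespace FourBody

open InnerProductGeometry Set

theorem exists_eq_mul_mul_of_rows_eq_mul {ι K : Type*} [Field K] {S : ι → ι → K} {w : ι → K}
    (hS : ∀ i j, S i j = S j i) (hw : ∀ i, w i ≠ 0)
    (hrow : ∀ i, ∃ μ, ∀ j ≠ i, S i j = μ * w j) :
    ∃ ν, ∀ i j, i ≠ j → S i j = ν * (w i * w j) := by
  choose μ hμ using hrow
  rcases isEmpty_or_nonempty ι with _ | ⟨⟨i₀⟩⟩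
  · exact ⟨0, isEmptyElim⟩
  have hconst : ∀ i, μ i / w i = μ i₀ / w i₀ := by
    intro i
    rcases eq_or_ne i i₀ with rfl | hi
    · rfl
    · rw [div_eq_div_iff (hw i) (hw i₀), ← hμ i i₀ hi.symm, hS, hμ i₀ i hi]
  refine ⟨μ i₀ / w i₀, fun i j hij => ?_⟩
  rw [hμ i j hij.symm, ← hconst i, ← mul_assoc, div_mul_cancel₀ _ (hw i)]

theorem sum_smul_centerMass_sub {ι R E : Type*} [Field R] [AddCommGroup E] [Module R E]
    {t : Finset ι} {w : ι → R} (hw : ∑ i ∈ t, w i ≠ 0) (z : ι → E) (x : E) :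
    (∑ i ∈ t, w i) • (t.centerMass w z - x) = ∑ i ∈ t, w i • (z i - x) := by
  simp only [smul_sub, Finset.sum_sub_distrib, ← Finset.sum_smul, Finset.centerMass,
    smul_inv_smul₀ hw]

section Angles

variable {V : Type*} [NormedAddCommGroup V] [InnerProductSpace ℝ V]

theorem cot_angle (x y : V) :
    Real.cot (angle x y) = inner ℝ x y / (Real.sin (angle x y) * (‖x‖ * ‖y‖)) := by
  rcases eq_or_ne x 0 with rfl | hx
  · simp [Real.cot_eq_cos_div_sin]
  rcases eq_or_ne y 0 with rfl | hy
  · simp [Real.cot_eq_cos_div_sin]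
  have hxy : ‖x‖ * ‖y‖ ≠ 0 := mul_ne_zero (norm_ne_zero_iff.2 hx) (norm_ne_zero_iff.2 hy)
  rw [Real.cot_eq_cos_div_sin, ← cos_angle_mul_norm_mul_norm, mul_div_mul_right _ _ hxy]

theorem inner_smul_add_smul (x y : V) (a b c d : ℝ) :
    inner ℝ (a • x + b • y) (c • x + d • y) =
      a * c * ‖x‖ ^ 2 + (a * d + b * c) * inner ℝ x y + b * d * ‖y‖ ^ 2 := by
  simp only [inner_add_left, inner_add_right, real_inner_smul_left, real_inner_smul_right,
    real_inner_self_eq_norm_sq, real_inner_comm x y]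
  ring

theorem sin_angle_smul_add_smul_mul_norm (x y : V) (a b c d : ℝ) :
    Real.sin (angle (a • x + b • y) (c • x + d • y)) *
        (‖a • x + b • y‖ * ‖c • x + d • y‖) =
      |a * d - b * c| * (Real.sin (angle x y) * (‖x‖ * ‖y‖)) := by
  rw [sin_angle_mul_norm_mul_norm, sin_angle_mul_norm_mul_norm, ← Real.sqrt_sq_eq_abs,
    ← Real.sqrt_mul (sq_nonneg _)]
  congr 1
  simp only [inner_smul_add_smul]
  simp only [real_inner_self_eq_norm_sq]
  ring

theorem cot_angle_smul_add_smul (x y : V) (a b c d : ℝ) :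
    Real.cot (angle (a • x + b • y) (c • x + d • y)) =
      (a * c * (‖x‖ / ‖y‖ * (Real.sin (angle x y))⁻¹) + (a * d + b * c) * Real.cot (angle x y) +
        b * d * (‖y‖ / ‖x‖ * (Real.sin (angle x y))⁻¹)) / |a * d - b * c| := by
  rw [cot_angle, sin_angle_smul_add_smul_mul_norm, inner_smul_add_smul, cot_angle x y]
  -- A vanishing determinant or sine makes both sides `0`, by division by zero.
  rcases eq_or_ne x 0 with rfl | hx
  · simp
  rcases eq_or_ne y 0 with rfl | hy
  · simp
  have hx' := norm_ne_zero_iff.2 hx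
  have hy' := norm_ne_zero_iff.2 hy
  field_simp

theorem sin_angle_pos_of_linearIndependent {x y : V} (h : LinearIndependent ℝ ![x, y]) :
    0 < Real.sin (angle x y) := by
  refine (sin_angle_nonneg x y).lt_of_ne' fun h0 => ?_
  have hne := (LinearIndependent.pair_iff' (h.ne_zero 0)).1 h
  rcases sin_eq_zero_iff_angle_eq_zero_or_angle_eq_pi.1 h0 with h0 | hπ
  · obtain ⟨-, r, -, hr⟩ := angle_eq_zero_iff.1 h0
    exact hne r hr.symm
  · obtain ⟨-, r, -, hr⟩ := angle_eq_pi_iff.1 hπ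
    exact hne r hr.symm

end Angles

theorem cross_smul_add_smul (x y : Plane) (a b c d : ℝ) :
    cross (a • x + b • y) (c • x + d • y) = (a * d - b * c) * cross x y := by
  simp only [cross, PiLp.add_apply, PiLp.smul_apply, smul_eq_mul]
  ring

/-- The diagonals `q₁q₃` and `q₂q₄` are not parallel and cross at an interior point of both,
dividing them in the ratios `s : 1 - s` and `t : 1 - t`. -/
structure CrossingDiagonals {E : Type*} [AddCommGroup E] [Module ℝ E] (q : Fin 4 → E)
    (s t : ℝ) : Prop where
  left_mem : s ∈ Ioo (0 : ℝ) 1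
  right_mem : t ∈ Ioo (0 : ℝ) 1
  linearIndependent : LinearIndependent ℝ ![q 2 - q 0, q 3 - q 1]
  crossing : q 0 + s • (q 2 - q 0) = q 1 + t • (q 3 - q 1)

/-- The coordinates of the four points along the diagonal `q₁q₃`, measured from the crossing
point in units of `q₃ - q₁`. -/
def leftCoord (s : ℝ) : Fin 4 → ℝ := ![-s, 0, 1 - s, 0]

/-- The coordinates of the four points along the diagonal `q₂q₄`, measured from the crossing
point in units of `q₄ - q₂`. -/
def rightCoord (t : ℝ) : Fin 4 → ℝ := ![0, -t, 0, 1 - t]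

/-- The affine dependency of four points whose diagonals cross in the ratios `s : 1 - s` and
`t : 1 - t`. Up to a common factor its entries are the signed areas of the triangles obtained by
omitting one point. -/
def affineDependency (s t : ℝ) : Fin 4 → ℝ := ![1 - s, -(1 - t), s, -t]

theorem affineDependency_ne_zero {s t : ℝ} (hs : s ∈ Ioo (0 : ℝ) 1) (ht : t ∈ Ioo (0 : ℝ) 1)
    (i : Fin 4) : affineDependency s t i ≠ 0 := by
  have hs₀ := hs.1.ne'
  have hs₁ := (sub_pos.2 hs.2).ne'
  have ht₀ := ht.1.ne'
  have ht₁ := (sub_pos.2 ht.2).ne'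
  fin_cases i
  exacts [hs₁, neg_ne_zero.2 ht₁, hs₀, neg_ne_zero.2 ht₀]

/-- Dziobek's equations `mᵢ mⱼ (rᵢⱼ⁻³ - l) = ν wᵢ wⱼ`, solved for `rᵢⱼ⁻³`, with multipliers `l` and
`ν` and with `w` in the role of the signed areas. -/
def DziobekEquations {ι P : Type*} [Dist P] (m : ι → ℝ) (q : ι → P) (w : ι → ℝ)
    (l ν : ℝ) : Prop :=
  ∀ i j, i ≠ j → (dist (q i) (q j) ^ 3)⁻¹ = l + ν / (m i * m j) * (w i * w j)

theorem DziobekEquations.dist_le_dist {ι P : Type*} [MetricSpace P] {m w : ι → ℝ} {q : ι → P}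
    {l ν : ℝ} (h : DziobekEquations m q w l ν) (hm : ∀ i, 0 < m i) (hq : Function.Injective q)
    (hν : 0 ≤ ν) {i j k n : ι} (hij : i ≠ j) (hkn : k ≠ n) (hwij : w i * w j ≤ 0)
    (hwkn : 0 ≤ w k * w n) : dist (q k) (q n) ≤ dist (q i) (q j) := by
  have hcoeff : ∀ i j, 0 ≤ ν / (m i * m j) := fun i j => div_nonneg hν (mul_pos (hm i) (hm j)).le
  have hij_pos : 0 < dist (q i) (q j) := dist_pos.2 (hq.ne hij)
  have hkn_pos : 0 < dist (q k) (q n) := dist_pos.2 (hq.ne hkn)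
  refine le_of_pow_le_pow_left₀ three_ne_zero hij_pos.le
    ((inv_le_inv₀ (pow_pos hij_pos 3) (pow_pos hkn_pos 3)).1 ?_)
  calc (dist (q i) (q j) ^ 3)⁻¹ = l + ν / (m i * m j) * (w i * w j) := h i j hij
    _ ≤ l := add_le_of_nonpos_right (mul_nonpos_of_nonneg_of_nonpos (hcoeff i j) hwij)
    _ ≤ l + ν / (m k * m n) * (w k * w n) := le_add_of_nonneg_right (mul_nonneg (hcoeff k n) hwkn)
    _ = (dist (q k) (q n) ^ 3)⁻¹ := (h k n hkn).symm

namespace CrossingDiagonals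

section Module

variable {E : Type*} [AddCommGroup E] [Module ℝ E] {q : Fin 4 → E} {s t : ℝ}

theorem eq_crossing_add (h : CrossingDiagonals q s t) (i : Fin 4) :
    q i = (q 0 + s • (q 2 - q 0)) +
      (leftCoord s i • (q 2 - q 0) + rightCoord t i • (q 3 - q 1)) := by
  fin_cases i
  · simp [leftCoord, rightCoord]
  · simp [leftCoord, rightCoord, h.crossing]
  · simp [leftCoord, rightCoord, sub_smul]
  · simp [leftCoord, rightCoord, h.crossing, sub_smul]

theorem sub_eq_smul_add_smul (h : CrossingDiagonals q s t) (i j : Fin 4) :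
    q i - q j = (leftCoord s i - leftCoord s j) • (q 2 - q 0) +
      (rightCoord t i - rightCoord t j) • (q 3 - q 1) := by
  conv_lhs => rw [h.eq_crossing_add i, h.eq_crossing_add j]
  module

theorem injective (h : CrossingDiagonals q s t) : Function.Injective q := by
  intro i j hij
  have hs := h.left_mem
  have ht := h.right_mem
  obtain ⟨hleft, hright⟩ := LinearIndependent.pair_iff.1 h.linearIndependent _ _
    ((h.sub_eq_smul_add_smul i j).symm.trans (sub_eq_zero.2 hij))
  fin_cases i <;> fin_cases j <;>
    simp only [leftCoord, rightCoord, Fin.mk_one, Fin.zero_eta, Fin.reduceFinMk,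
      Matrix.cons_val] at hleft hright <;>
    grind

theorem eq_mul_affineDependency (h : CrossingDiagonals q s t) {w : Fin 4 → ℝ}
    (hw : ∑ j, w j = 0) {i : Fin 4} (hwq : ∑ j, w j • (q j - q i) = 0) (j : Fin 4) :
    w j = (w 0 + w 2) * affineDependency s t j := by
  have hwcoord : (∑ j, w j * leftCoord s j) • (q 2 - q 0) +
      (∑ j, w j * rightCoord t j) • (q 3 - q 1) = 0 := by
    rw [← hwq]
    simp only [h.sub_eq_smul_add_smul _ i, smul_add, smul_smul, mul_sub, Finset.sum_add_distrib,
      ← Finset.sum_smul, Finset.sum_sub_distrib, ← Finset.sum_mul, hw, zero_mul, sub_zero]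
  obtain ⟨hleft, hright⟩ := LinearIndependent.pair_iff.1 h.linearIndependent _ _ hwcoord
  simp only [Fin.sum_univ_four, leftCoord, rightCoord, Matrix.cons_val] at hw hleft hright
  fin_cases j
  · change w 0 = (w 0 + w 2) * (1 - s)
    linear_combination -hleft
  · change w 1 = (w 0 + w 2) * -(1 - t)
    linear_combination (1 - t) * hw - hright
  · change w 2 = (w 0 + w 2) * s
    linear_combination hleft
  · change w 3 = (w 0 + w 2) * -t
    linear_combination t * hw + hright

theorem exists_eq_mul_affineDependency (h : CrossingDiagonals q s t) {c : Fin 4 → ℝ} {i : Fin 4}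
    (hc : ∑ j, c j • (q j - q i) = 0) :
    ∃ μ, ∀ j ≠ i, c j = μ * affineDependency s t j := by
  -- The term `j = i` of `hc` vanishes, so `c i` may be changed to make the coefficients sum to `0`.
  obtain ⟨w, hwc, hw⟩ : ∃ w : Fin 4 → ℝ, (∀ j ≠ i, w j = c j) ∧ ∑ j, w j = 0 :=
    ⟨c - Pi.single i (∑ j, c j), fun j hj => by simp [hj], by simp⟩
  have hwq : ∑ j, w j • (q j - q i) = 0 := by
    rw [← hc]
    refine Finset.sum_congr rfl fun j _ => ?_
    rcases eq_or_ne j i with rfl | hj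
    · simp
    · rw [hwc j hj]
  exact ⟨w 0 + w 2, fun j hj => by rw [← hwc j hj, ← h.eq_mul_affineDependency hw hwq]⟩

end Module

theorem dist_add_dist_lt {E : Type*} [NormedAddCommGroup E] [NormedSpace ℝ E]
    [StrictConvexSpace ℝ E] {q : Fin 4 → E} {s t : ℝ} (h : CrossingDiagonals q s t) :
    dist (q 0) (q 1) + dist (q 2) (q 3) < dist (q 0) (q 2) + dist (q 1) (q 3) := by
  obtain ⟨hs₀, hs₁⟩ := h.left_mem
  obtain ⟨ht₀, ht₁⟩ := h.right_mem
  set e := q 2 - q 0 with he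
  set f := q 3 - q 1 with hf
  have h01 : q 1 - q 0 = s • e - t • f := by
    rw [h.sub_eq_smul_add_smul 1 0, ← he, ← hf]
    simp only [leftCoord, rightCoord, Matrix.cons_val]
    module
  have h23 : q 2 - q 3 = (1 - s) • e - (1 - t) • f := by
    rw [h.sub_eq_smul_add_smul 2 3, ← he, ← hf]
    simp only [leftCoord, rightCoord, Matrix.cons_val]
    module
  have hray : ¬ SameRay ℝ (s • e) (-(t • f)) := fun hsame => by
    refine sameRay_or_sameRay_neg_iff_not_linearIndependent.1 (.inr hsame) ?_
    refine LinearIndependent.pair_iff.2 fun a b hab => ?_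
    simpa [hs₀.ne', ht₀.ne'] using
      LinearIndependent.pair_iff.1 h.linearIndependent (a * s) (b * t) (by simpa [mul_smul])
  calc dist (q 0) (q 1) + dist (q 2) (q 3)
      = ‖s • e + -(t • f)‖ + ‖(1 - s) • e - (1 - t) • f‖ := by
        rw [dist_comm, dist_eq_norm, dist_eq_norm, h01, h23, sub_eq_add_neg]
    _ < (‖s • e‖ + ‖-(t • f)‖) + (‖(1 - s) • e‖ + ‖(1 - t) • f‖) :=
        add_lt_add_of_lt_of_le (norm_add_lt_of_not_sameRay hray) (norm_sub_le _ _)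
    _ = ‖e‖ + ‖f‖ := by
        rw [norm_neg, norm_smul_of_nonneg hs₀.le, norm_smul_of_nonneg ht₀.le,
          norm_smul_of_nonneg (sub_nonneg.2 hs₁.le), norm_smul_of_nonneg (sub_nonneg.2 ht₁.le)]
        ring
    _ = dist (q 0) (q 2) + dist (q 1) (q 3) := by
        rw [dist_comm (q 0), dist_comm (q 1), dist_eq_norm, dist_eq_norm]

theorem dziobek_multiplier_neg {E : Type*} [NormedAddCommGroup E] [NormedSpace ℝ E]
    [StrictConvexSpace ℝ E] {m : Fin 4 → ℝ} {q : Fin 4 → E} {s t l ν : ℝ}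
    (h : CrossingDiagonals q s t) (hm : ∀ i, 0 < m i)
    (hν : DziobekEquations m q (affineDependency s t) l ν) : ν < 0 := by
  obtain ⟨hs₀, hs₁⟩ := h.left_mem
  obtain ⟨ht₀, ht₁⟩ := h.right_mem
  have h01 : (1 - s) * -(1 - t) ≤ 0 :=
    mul_nonpos_of_nonneg_of_nonpos (sub_pos.2 hs₁).le (neg_nonpos.2 (sub_pos.2 ht₁).le)
  have h02 : 0 ≤ (1 - s) * s := mul_nonneg (sub_pos.2 hs₁).le hs₀.le
  have h13 : 0 ≤ -(1 - t) * -t :=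
    mul_nonneg_of_nonpos_of_nonpos (neg_nonpos.2 (sub_pos.2 ht₁).le) (neg_nonpos.2 ht₀.le)
  have h23 : s * -t ≤ 0 := mul_nonpos_of_nonneg_of_nonpos hs₀.le (neg_nonpos.2 ht₀.le)
  by_contra! hν₀
  have hle₀₂ : dist (q 0) (q 2) ≤ dist (q 0) (q 1) :=
    hν.dist_le_dist hm h.injective hν₀ (by decide) (by decide) h01 h02
  have hle₁₃ : dist (q 1) (q 3) ≤ dist (q 2) (q 3) :=
    hν.dist_le_dist hm h.injective hν₀ (by decide) (by decide) h23 h13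
  linarith [h.dist_add_dist_lt]

end CrossingDiagonals

/-- The ratio between the multiplier of `DziobekEquations` and the multiplier `η₁` of
`AngleEquations`, for a quadrilateral whose diagonal `q₁q₃` is divided in the ratio `s : 1 - s`. -/
noncomputable def dziobekFactor (q : Fin 4 → Plane) (s : ℝ) : ℝ :=
  dist (q 1) (q 3) / dist (q 0) (q 2) * (Real.sin (diagonalAngle q))⁻¹ / (s * (1 - s))

namespace CrossingDiagonals

section Plane

variable {q : Fin 4 → Plane} {s t : ℝ}

theorem cot_vertexAngle (h : CrossingDiagonals q s t) (i j k : Fin 4) :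
    Real.cot (vertexAngle q i j k) =
      ((leftCoord s i - leftCoord s j) * (leftCoord s k - leftCoord s j) *
          (dist (q 0) (q 2) / dist (q 1) (q 3) * (Real.sin (diagonalAngle q))⁻¹) +
        ((leftCoord s i - leftCoord s j) * (rightCoord t k - rightCoord t j) +
          (rightCoord t i - rightCoord t j) * (leftCoord s k - leftCoord s j)) *
            Real.cot (diagonalAngle q) +
        (rightCoord t i - rightCoord t j) * (rightCoord t k - rightCoord t j) *
          (dist (q 1) (q 3) / dist (q 0) (q 2) * (Real.sin (diagonalAngle q))⁻¹)) /
      |(leftCoord s i - leftCoord s j) * (rightCoord t k - rightCoord t j) -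
        (rightCoord t i - rightCoord t j) * (leftCoord s k - leftCoord s j)| := by
  rw [vertexAngle, EuclideanGeometry.angle, vsub_eq_sub, vsub_eq_sub, h.sub_eq_smul_add_smul i j,
    h.sub_eq_smul_add_smul k j, cot_angle_smul_add_smul, diagonalAngle, dist_eq_norm',
    dist_eq_norm']

theorem cot_sub_cot_vertexAngle_031 (h : CrossingDiagonals q s t) :
    Real.cot (diagonalAngle q) - Real.cot (vertexAngle q 0 3 1) =
      dziobekFactor q s * (affineDependency s t 0 * affineDependency s t 1) := by
  have hs₀ := h.left_mem.1
  have hs₁ := sub_pos.2 h.left_mem.2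
  rw [h.cot_vertexAngle 0 3 1, dziobekFactor]
  simp only [leftCoord, rightCoord, affineDependency, Matrix.cons_val]
  rw [show (-s - 0) * (-t - (1 - t)) - (0 - (1 - t)) * (0 - 0) = s by ring, abs_of_pos hs₀]
  field_simp
  ring

theorem neg_cot_sub_cot_vertexAngle_013 (h : CrossingDiagonals q s t) :
    -Real.cot (diagonalAngle q) - Real.cot (vertexAngle q 0 1 3) =
      dziobekFactor q s * (affineDependency s t 0 * affineDependency s t 3) := by
  have hs₀ := h.left_mem.1
  have hs₁ := sub_pos.2 h.left_mem.2
  rw [h.cot_vertexAngle 0 1 3, dziobekFactor]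
  simp only [leftCoord, rightCoord, affineDependency, Matrix.cons_val]
  rw [show (-s - 0) * (1 - t - -t) - (0 - -t) * (0 - 0) = -s by ring, abs_neg, abs_of_pos hs₀]
  field_simp
  ring

theorem neg_cot_sub_cot_vertexAngle_132 (h : CrossingDiagonals q s t) :
    -Real.cot (diagonalAngle q) - Real.cot (vertexAngle q 1 3 2) =
      dziobekFactor q s * (affineDependency s t 1 * affineDependency s t 2) := by
  have hs₀ := h.left_mem.1
  have hs₁ := sub_pos.2 h.left_mem.2
  rw [h.cot_vertexAngle 1 3 2, dziobekFactor]
  simp only [leftCoord, rightCoord, affineDependency, Matrix.cons_val]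
  rw [show (0 - 0) * (0 - (1 - t)) - (-t - (1 - t)) * (1 - s - 0) = 1 - s by ring, abs_of_pos hs₁]
  field_simp
  ring

theorem cot_sub_cot_vertexAngle_213 (h : CrossingDiagonals q s t) :
    Real.cot (diagonalAngle q) - Real.cot (vertexAngle q 2 1 3) =
      dziobekFactor q s * (affineDependency s t 2 * affineDependency s t 3) := by
  have hs₀ := h.left_mem.1
  have hs₁ := sub_pos.2 h.left_mem.2
  rw [h.cot_vertexAngle 2 1 3, dziobekFactor]
  simp only [leftCoord, rightCoord, affineDependency, Matrix.cons_val]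
  rw [show (1 - s - 0) * (1 - t - -t) - (0 - -t) * (0 - 0) = 1 - s by ring, abs_of_pos hs₁]
  field_simp
  ring

theorem ratio_mul_csc_sub_cot_vertexAngle_123_sub_103 (h : CrossingDiagonals q s t) :
    dist (q 0) (q 2) / dist (q 1) (q 3) * (Real.sin (diagonalAngle q))⁻¹ -
        Real.cot (vertexAngle q 1 2 3) - Real.cot (vertexAngle q 1 0 3) =
      dziobekFactor q s * (affineDependency s t 1 * affineDependency s t 3) := by
  have hs₀ := h.left_mem.1
  have hs₁ := sub_pos.2 h.left_mem.2
  rw [h.cot_vertexAngle 1 2 3, h.cot_vertexAngle 1 0 3, dziobekFactor]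
  simp only [leftCoord, rightCoord, affineDependency, Matrix.cons_val]
  rw [show (0 - (1 - s)) * (1 - t - 0) - (-t - 0) * (0 - (1 - s)) = -(1 - s) by ring,
    show (0 - -s) * (1 - t - 0) - (-t - 0) * (0 - -s) = s by ring, abs_neg, abs_of_pos hs₀,
    abs_of_pos hs₁]
  field_simp
  ring

theorem ratio_mul_csc_diagonalAngle (h : CrossingDiagonals q s t) :
    dist (q 1) (q 3) / dist (q 0) (q 2) * (Real.sin (diagonalAngle q))⁻¹ =
      dziobekFactor q s * (affineDependency s t 0 * affineDependency s t 2) := by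
  have hs₀ := h.left_mem.1.ne'
  have hs₁ := (sub_pos.2 h.left_mem.2).ne'
  simp only [dziobekFactor, affineDependency, Matrix.cons_val]
  rw [mul_comm (1 - s), div_mul_cancel₀ _ (mul_ne_zero hs₀ hs₁)]

theorem planarityConstraint_eq_zero (h : CrossingDiagonals q s t) :
    planarityConstraint q = 0 := by
  rw [planarityConstraint, h.sub_eq_smul_add_smul 2 1, h.sub_eq_smul_add_smul 3 2,
    h.sub_eq_smul_add_smul 0 3, h.sub_eq_smul_add_smul 1 0, cross_smul_add_smul,
    cross_smul_add_smul]
  simp only [leftCoord, rightCoord, Matrix.cons_val]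
  rw [show (1 - s - 0) * (1 - t - 0) - (0 - -t) * (0 - (1 - s)) = 1 - s by ring,
    show (-s - 0) * (-t - 0) - (0 - (1 - t)) * (0 - -s) = s by ring, abs_mul, abs_mul,
    abs_of_pos h.left_mem.1, abs_of_pos (sub_pos.2 h.left_mem.2)]
  ring

theorem dziobekFactor_pos (h : CrossingDiagonals q s t) : 0 < dziobekFactor q s := by
  have hsin : 0 < Real.sin (diagonalAngle q) :=
    sin_angle_pos_of_linearIndependent h.linearIndependent
  have h02 : 0 < dist (q 0) (q 2) := dist_pos.2 (h.injective.ne (by decide))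
  have h13 : 0 < dist (q 1) (q 3) := dist_pos.2 (h.injective.ne (by decide))
  exact div_pos (mul_pos (div_pos h13 h02) (inv_pos.2 hsin))
    (mul_pos h.left_mem.1 (sub_pos.2 h.left_mem.2))

theorem angleEquations_iff_dziobekEquations (h : CrossingDiagonals q s t) {m : Fin 4 → ℝ}
    {l η : ℝ} : AngleEquations m q l η ↔
      DziobekEquations m q (affineDependency s t) l (η * dziobekFactor q s) := by
  have regroup : ∀ a b : ℝ, l + η / a * (dziobekFactor q s * b) =
      l + η * dziobekFactor q s / a * b := fun a b => by ring
  constructor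
  · intro hη
    suffices hlt : ∀ i j, i < j → (dist (q i) (q j) ^ 3)⁻¹ = l + η * dziobekFactor q s /
        (m i * m j) * (affineDependency s t i * affineDependency s t j) by
      intro i j hij
      rcases hij.lt_or_gt with hij | hij
      · exact hlt i j hij
      · rw [dist_comm, mul_comm (m i), mul_comm (affineDependency s t i), hlt j i hij]
    obtain ⟨h12, h13, h14, h23, h24, h34, -⟩ := hη
    rw [h.cot_sub_cot_vertexAngle_031, regroup] at h12
    rw [h.ratio_mul_csc_diagonalAngle, regroup] at h13
    rw [h.neg_cot_sub_cot_vertexAngle_013, regroup] at h14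
    rw [h.neg_cot_sub_cot_vertexAngle_132, regroup] at h23
    rw [h.ratio_mul_csc_sub_cot_vertexAngle_123_sub_103, regroup] at h24
    rw [h.cot_sub_cot_vertexAngle_213, regroup] at h34
    intro i j hij
    fin_cases i <;> fin_cases j <;> first | assumption | exact absurd hij (by decide)
  · intro hν
    refine ⟨?_, ?_, ?_, ?_, ?_, ?_, h.planarityConstraint_eq_zero⟩
    · rw [h.cot_sub_cot_vertexAngle_031, regroup, hν 0 1 (by decide)]
    · rw [h.ratio_mul_csc_diagonalAngle, regroup, hν 0 2 (by decide)]
    · rw [h.neg_cot_sub_cot_vertexAngle_013, regroup, hν 0 3 (by decide)]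
    · rw [h.neg_cot_sub_cot_vertexAngle_132, regroup, hν 1 2 (by decide)]
    · rw [h.ratio_mul_csc_sub_cot_vertexAngle_123_sub_103, regroup, hν 1 3 (by decide)]
    · rw [h.cot_sub_cot_vertexAngle_213, regroup, hν 2 3 (by decide)]

end Plane

end CrossingDiagonals

theorem IsCentralConfiguration.exists_multiplier_sum_smul_sub_eq_zero {m : Fin 4 → ℝ}
    {q : Fin 4 → Plane} (h : IsCentralConfiguration m q) (hm : ∑ i, m i ≠ 0) :
    ∃ l : ℝ, ∀ i, ∑ j, (m i * m j * ((dist (q i) (q j) ^ 3)⁻¹ - l)) • (q j - q i) = 0 := by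
  obtain ⟨-, l, hl⟩ := h
  refine ⟨-(l / ∑ i, m i), fun i => ?_⟩
  have hforce : ∑ j, (m i * m j / dist (q i) (q j) ^ 3) • (q j - q i) =
      (l * m i) • (q i - Finset.univ.centerMass m q) := by
    rw [hl i, Finset.sum_erase Finset.univ (by simp)]
  calc ∑ j, (m i * m j * ((dist (q i) (q j) ^ 3)⁻¹ - -(l / ∑ k, m k))) • (q j - q i)
      = ∑ j, (m i * m j / dist (q i) (q j) ^ 3) • (q j - q i) +
          (m i * (l / ∑ k, m k)) • ∑ j, m j • (q j - q i) := by
        rw [Finset.smul_sum, ← Finset.sum_add_distrib]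
        refine Finset.sum_congr rfl fun j _ => ?_
        module
    _ = (l * m i) • (q i - Finset.univ.centerMass m q) +
          (m i * l) • (Finset.univ.centerMass m q - q i) := by
        rw [hforce, ← sum_smul_centerMass_sub hm, smul_smul, mul_assoc, div_mul_cancel₀ _ hm]
    _ = 0 := by module

theorem CrossingDiagonals.exists_dziobekEquations {m : Fin 4 → ℝ} {q : Fin 4 → Plane} {s t : ℝ}
    (h : CrossingDiagonals q s t) (hm : ∀ i, m i ≠ 0) (hM : ∑ i, m i ≠ 0)
    (hcc : IsCentralConfiguration m q) :
    ∃ l ν : ℝ, DziobekEquations m q (affineDependency s t) l ν := by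
  obtain ⟨l, hl⟩ := hcc.exists_multiplier_sum_smul_sub_eq_zero hM
  obtain ⟨ν, hν⟩ := exists_eq_mul_mul_of_rows_eq_mul
    (S := fun i j => m i * m j * ((dist (q i) (q j) ^ 3)⁻¹ - l))
    (fun i j => by rw [mul_comm (m i), dist_comm])
    (affineDependency_ne_zero h.left_mem h.right_mem)
    (fun i => h.exists_eq_mul_affineDependency (hl i))
  refine ⟨l, ν, fun i j hij => ?_⟩
  rw [← sub_eq_iff_eq_add', div_mul_eq_mul_div, eq_div_iff (mul_ne_zero (hm i) (hm j)),
    ← hν i j hij, mul_comm]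

theorem IsStandardConvex.notMem_segment {q : Fin 4 → Plane} (h : IsStandardConvex q)
    {i j k : Fin 4} (hij : i ≠ j) (hik : i ≠ k) (hjk : j ≠ k) :
    q j ∉ segment ℝ (q i) (q k) := fun hj =>
  h.nondegenerate i j k hij hik hjk (mem_segment_iff_wbtw.1 hj).collinear

theorem IsStandardConvex.exists_crossingDiagonals {q : Fin 4 → Plane}
    (h : IsStandardConvex q) : ∃ s t, CrossingDiagonals q s t := by
  obtain ⟨p, h02, h13⟩ := h.ordered
  have hp : ∀ i, p ≠ q i := by
    rintro i rfl
    fin_cases i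
    · exact h.notMem_segment (by decide) (by decide) (by decide) h13
    · exact h.notMem_segment (by decide) (by decide) (by decide) h02
    · exact h.notMem_segment (by decide) (by decide) (by decide) h13
    · exact h.notMem_segment (by decide) (by decide) (by decide) h02
  obtain ⟨s, hs, hsp⟩ := openSegment_eq_image' ℝ (q 0) (q 2) ▸
    mem_openSegment_of_ne_left_right (hp 0).symm (hp 2).symm h02
  obtain ⟨t, ht, htp⟩ := openSegment_eq_image' ℝ (q 1) (q 3) ▸
    mem_openSegment_of_ne_left_right (hp 1).symm (hp 3).symm h13
  have hcross : q 0 + s • (q 2 - q 0) = q 1 + t • (q 3 - q 1) := hsp.trans htp.symm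
  have h20 : q 2 - q 0 ≠ 0 := sub_ne_zero.2 (h.convex.injective.ne (by decide))
  refine ⟨s, t, hs, ht, (LinearIndependent.pair_iff' h20).2 fun a ha => ?_, hcross⟩
  have hq1 : q 1 = AffineMap.lineMap (q 0) (q 2) (s - t * a) := by
    rw [AffineMap.lineMap_apply_module', eq_sub_of_add_eq hcross.symm, ← ha]
    module
  refine h.nondegenerate 1 0 2 (by decide) (by decide) (by decide) ?_
  rw [hq1]
  exact collinear_insert_of_mem_affineSpan_pair (AffineMap.lineMap_mem_affineSpan_pair _ _ _)

end FourBody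

theorem mainTheorem9 (m : Fin 4 → ℝ) (hm : ∀ i, 0 < m i)
    (q : Fin 4 → FourBody.Plane)
    (hcc : FourBody.IsCentralConfiguration m q)
    (hstd : FourBody.IsStandardConvex q) :
    (∃ l η₁ : ℝ, FourBody.AngleEquations m q l η₁) ∧
      ∀ l η₁ : ℝ, FourBody.AngleEquations m q l η₁ → η₁ < 0 := by
  obtain ⟨s, t, h⟩ := hstd.exists_crossingDiagonals
  constructor
  · have hM : 0 < ∑ i, m i := Finset.sum_pos (fun i _ => hm i) Finset.univ_nonempty
    obtain ⟨l, ν, hν⟩ := h.exists_dziobekEquations (fun i => (hm i).ne') hM.ne' hcc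
    refine ⟨l, ν / FourBody.dziobekFactor q s, h.angleEquations_iff_dziobekEquations.2 ?_⟩
    rwa [div_mul_cancel₀ _ h.dziobekFactor_pos.ne']
  · intro l η₁ hη
    have hneg := h.dziobek_multiplier_neg hm (h.angleEquations_iff_dziobekEquations.1 hη)
    exact neg_of_mul_neg_left hneg h.dziobekFactor_pos.le
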